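/- Let $n\ge 1$, let $\Omega\subset\mathbb R^n$ be a bounded domain (nonempty, open and connected), let $\varepsilon>0$, $\alpha,\beta>0$, $\alpha+\beta=1$, and put $$\Gamma_\varepsilon=\{x\in\mathbb R^n\setminus\Omega:\operatorname{dist}(x,\Omega)\le\varepsilon\},\qquad \Omega_\varepsilon=\Omega\cup\Gamma_\varepsilon .$$ For a bounded Borel function $v:\Omega_\varepsilon\to\mathbb R$ let $$Tv(x)=\frac{\alpha}{2}\sup_{B_\varepsilon(x)}v+\frac{\alpha}{2}\inf_{B_\varepsilon(x)}v+\frac{\beta}{|B_\varepsilon(x)|}\int_{B_\varepsilon(x)}v\,dy\quad (x\in\Omega),\qquad Tv(x)=v(x)\quad (x\in\Gamma_\varepsilon),$$ where $B_\varepsilon(x)$ is the open ball. Let $F:\Gamma_\varepsilon\to\mathbb R$ be bounded and Borel. Tug-of-war with noise starts at a point $x_0\in\Omega_\varepsilon$. While the current position $x_k$ lies in $\Omega$, a coin toss $c_{k+1}\in\{0,1,2\}$ with probabilities $\frac\alpha2,\frac\alpha2,\beta$ decides whether Player I moves, Player II moves, or $x_{k+1}$ is chosen uniformly at random in $B_\varepsilon(x_k)$.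 A strategy ($S_{\mathrm I}$ of Player I, $S_{\mathrm{II}}$ of Player II) is a sequence of Borel functions that give the next position $x_{k+1}\in B_\varepsilon(x_k)$ of a player's move in terms of the history $(x_0,(c_1,x_1),\dots,(c_k,x_k))$. The game ends at the first time $\tau\ge 0$ with $x_\tau\notin\Omega$, and Player II then pays $F(x_\tau)$ to Player I. Let $\mathbb E^{x_0}_{S_{\mathrm I},S_{\mathrm{II}}}$ denote the expectation for the resulting law on infinite runs of the game, and let $$u_{\mathrm I}(x_0)=\sup_{S_{\mathrm I}}\inf_{S_{\mathrm{II}}}\mathbb E^{x_0}_{S_{\mathrm I},S_{\mathrm{II}}}[F(x_\tau)],\qquad u_{\mathrm{II}}(x_0)=\inf_{S_{\mathrm{II}}}\sup_{S_{\mathrm I}}\mathbb E^{x_0}_{S_{\mathrm I},S_{\mathrm{II}}}[F(x_\tau)].$$ Then, for all strategies and all $x_0\in\Omega_\varepsilon$, almost surely $\tau<\infty$, and $F(x_\tau)$ is integrable. There is a unique bounded Borel function $u:\Omega_\varepsilon\to\mathbb R$ with $u=Tu$ and $u|_{\Gamma_\varepsilon}=F$; it is the uniform limit of the iterates $u_{j+1}=Tu_j$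 that start from $u_0=\inf_{\Gamma_\varepsilon}F$ in $\Omega$, $u_0=F$ on $\Gamma_\varepsilon$. Moreover $$u=u_{\mathrm I}=u_{\mathrm{II}}\quad\text{on }\Omega_\varepsilon .$$ In particular, the game has a value at each point, and the value function is Borel. -/

import Mathlib

open MeasureTheory ProbabilityTheory Filter Topology

noncomputable section

/-- The data of tug-of-war with noise in `ℝⁿ`: a bounded domain `Ω`, a step size `ε > 0`, and the
probabilities `α, β > 0`, `α + β = 1`, of a tug-of-war move and of a random move. -/
structure TugOfWar (n : ℕ) where
  Ω : Set (EuclideanSpace ℝ (Fin n))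
  ε : ℝ
  α : ℝ
  β : ℝ
  isOpen : IsOpen Ω
  isConnected : IsConnected Ω
  isBounded : Bornology.IsBounded Ω
  ε_pos : 0 < ε
  α_pos : 0 < α
  β_pos : 0 < β
  add_eq_one : α + β = 1

namespace TugOfWar

variable {n : ℕ} (G : TugOfWar n)

/-- The boundary strip `Γ_ε`: the points outside `Ω` at distance at most `ε` from `Ω`. -/
def strip : Set (EuclideanSpace ℝ (Fin n)) := {x | x ∉ G.Ω ∧ Metric.infDist x G.Ω ≤ G.ε}

/-- The extended domain `Ω_ε = Γ_ε ∪ Ω`. -/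
def extended : Set (EuclideanSpace ℝ (Fin n)) := G.strip ∪ G.Ω

/-- The set of positions of the token, `Ω_ε` as a type. It carries the Euclidean distance, the
Borel σ-algebra and the Lebesgue measure of `ℝⁿ`, restricted to it. For `x ∈ Ω` the ball
`Metric.ball x ε` of this type is the whole Euclidean ball `B_ε(x)`, by
`TugOfWar.image_ball` below. -/
abbrev Board : Type := G.extended

instance : MeasureSpace G.Board := Measure.Subtype.measureSpace

/-- The points of `Ω_ε` that lie in `Ω`. -/
def interiorBoard : Set G.Board := {x | (x : EuclideanSpace ℝ (Fin n)) ∈ G.Ω}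

/-- A point of `Ω_ε` that is not in `Ω`, as a point of the boundary strip. -/
def toStrip (x : G.Board) (hx : x ∉ G.interiorBoard) : G.strip := ⟨x, x.2.resolve_right hx⟩

/-- The inclusion of the boundary strip in `Ω_ε`. -/
def ofStrip (y : G.strip) : G.Board := ⟨y, Or.inl y.2⟩

/-! ### The dynamic programming principle -/

open Classical in
/-- The operator `T` of the dynamic programming principle. -/
def dppOp (u : G.Board → ℝ) (x : G.Board) : ℝ :=
  if x ∈ G.interiorBoard then
    G.α / 2 * (⨆ y : Metric.ball x G.ε, u y) + G.α / 2 * (⨅ y : Metric.ball x G.ε, u y)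
      + G.β * ⨍ y in Metric.ball x G.ε, u y
  else u x

/-- `u` is a bounded Borel function on `Ω_ε` that satisfies the dynamic programming principle
`u = T u` and has the boundary values `F`. -/
structure IsSolution (F : G.strip → ℝ) (u : G.Board → ℝ) : Prop where
  measurable : Measurable u
  bounded : ∃ C : ℝ, ∀ x, |u x| ≤ C
  dpp : u = G.dppOp u
  boundary : ∀ y : G.strip, u (G.ofStrip y) = F y

open Classical in
/-- The starting point of the iteration: `inf F` in `Ω`, and `F` on the boundary strip. -/
def iterStart (F : G.strip → ℝ) (x : G.Board) : ℝ :=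
  if hx : x ∈ G.interiorBoard then ⨅ y : G.strip, F y else F (G.toStrip x hx)

/-- The iterates `u₀`, `u_{j+1} = T u_j`. -/
def iter (F : G.strip → ℝ) (j : ℕ) : G.Board → ℝ := G.dppOp^[j] (G.iterStart F)

/-! ### Histories and strategies -/

/-- What is recorded at time `k`: the initial position `x₀` at time `0`, and the pair `(c_k, x_k)`
of coin toss and position at time `k ≥ 1`. The coin toss is `0` if Player I wins, `1` if
Player II wins, and `2` if a random step occurs. -/
def Stage : ℕ → Type
  | 0 => G.Board
  | _ + 1 => Fin 3 × G.Board

instance : ∀ k, MeasurableSpace (G.Stage k)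
  | 0 => inferInstanceAs (MeasurableSpace G.Board)
  | _ + 1 => inferInstanceAs (MeasurableSpace (Fin 3 × G.Board))

/-- The position of the token in the record of time `k`. -/
def pos : ∀ k, G.Stage k → G.Board
  | 0 => fun x => x
  | _ + 1 => fun s => Prod.snd s

/-- Histories `(x₀, (c₁, x₁), …, (c_k, x_k))` of the game up to step `k`. -/
abbrev History (k : ℕ) : Type := ∀ i : Finset.Iic k, G.Stage i

/-- The current position `x_k` in a history up to step `k`. -/
def current {k : ℕ} (h : G.History k) : G.Board :=
  G.pos k (h ⟨k, Finset.mem_Iic.2 le_rfl⟩)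

/-- A strategy: Borel functions that give the next position `x_{k+1} ∈ B_ε(x_k)` in terms of the
history up to step `k`. What it prescribes after the token has left `Ω` is irrelevant. -/
structure Strategy where
  move : ∀ k, G.History k → G.Board
  measurable_move : ∀ k, Measurable (move k)
  move_mem : ∀ k (h : G.History k), G.current h ∈ G.interiorBoard →
    move k h ∈ Metric.ball (G.current h) G.ε

/-! ### The law of the game -/

open Classical in
/-- The law of `(c_{k+1}, x_{k+1})` given the history up to step `k`. With probability `α / 2`
each, Player I moves the token according to `SI` or Player II according to `SII`, and with
probability `β` the token moves to a uniformly distributed point of `B_ε(x_k)`.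
The token does not move any more once it has left `Ω`. -/
def stepMeasure (SI SII : G.Strategy) (k : ℕ) (h : G.History k) : Measure (Fin 3 × G.Board) :=
  if G.current h ∈ G.interiorBoard then
    ENNReal.ofReal (G.α / 2) • Measure.dirac (0, SI.move k h)
      + ENNReal.ofReal (G.α / 2) • Measure.dirac (1, SII.move k h)
      + ENNReal.ofReal G.β •
        (ProbabilityTheory.cond volume (Metric.ball (G.current h) G.ε)).map (Prod.mk 2)
  else Measure.dirac (2, G.current h)

theorem measurable_pos : ∀ k, Measurable (G.pos k)
  | 0 => measurable_id
  | _ + 1 => measurable_snd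

theorem measurable_current (k : ℕ) : Measurable (G.current (k := k)) :=
  (G.measurable_pos k).comp (measurable_pi_apply _)

theorem measurableSet_interiorBoard : MeasurableSet G.interiorBoard :=
  measurable_subtype_coe G.isOpen.measurableSet

theorem measurableSet_extended : MeasurableSet G.extended := by
  have h1 : MeasurableSet {x | Metric.infDist x G.Ω ≤ G.ε} :=
    (isClosed_le (Metric.continuous_infDist_pt _) continuous_const).measurableSet
  exact ((G.isOpen.measurableSet.compl).inter h1).union G.isOpen.measurableSet

theorem ball_subset_extended {x : EuclideanSpace ℝ (Fin n)} (hx : x ∈ G.Ω) :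
    Metric.ball x G.ε ⊆ G.extended := by
  intro y hy
  by_cases h : y ∈ G.Ω
  · exact Or.inr h
  · exact Or.inl ⟨h, (Metric.infDist_le_dist_of_mem hx).trans (Metric.mem_ball.1 hy).le⟩

/-- For `x ∈ Ω` the ball around `x` in `Ω_ε` is the Euclidean ball. -/
theorem image_ball {x : G.Board} (hx : x ∈ G.interiorBoard) :
    (Subtype.val '' Metric.ball x G.ε : Set (EuclideanSpace ℝ (Fin n)))
      = Metric.ball (x : EuclideanSpace ℝ (Fin n)) G.ε := by
  ext y
  constructor
  · rintro ⟨z, hz, rfl⟩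
    exact hz
  · intro hy
    exact ⟨⟨y, G.ball_subset_extended hx hy⟩, hy, rfl⟩

theorem volume_ball {x : G.Board} (hx : x ∈ G.interiorBoard) :
    volume (Metric.ball x G.ε)
      = volume (Metric.ball (x : EuclideanSpace ℝ (Fin n)) G.ε) := by
  rw [← G.image_ball hx, Measure.Subtype.volume_def,
    comap_subtype_coe_apply G.measurableSet_extended]

instance : IsFiniteMeasure (volume : Measure G.Board) := by
  refine ⟨?_⟩
  rw [Measure.Subtype.volume_def, comap_subtype_coe_apply G.measurableSet_extended]
  refine (G.isBounded.cthickening (δ := G.ε)).measure_lt_top.trans_le' (measure_mono ?_)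
  rintro _ ⟨⟨x, hx⟩, -, rfl⟩
  rw [Metric.mem_cthickening_iff,
    ENNReal.le_ofReal_iff_toReal_le (Metric.infEDist_ne_top G.isConnected.nonempty) G.ε_pos.le]
  change Metric.infDist x G.Ω ≤ G.ε
  rcases hx with hx | hx
  · exact hx.2
  · simpa [Metric.infDist_zero_of_mem hx] using G.ε_pos.le

theorem measurable_volume_inter {B : Set G.Board} (hB : MeasurableSet B) :
    Measurable fun x : G.Board => volume (Metric.ball x G.ε ∩ B) := by
  have : MeasurableSet {p : G.Board × G.Board | dist p.2 p.1 < G.ε ∧ p.2 ∈ B} :=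
    (measurableSet_lt (measurable_snd.dist measurable_fst) measurable_const).inter
      (measurable_snd hB)
  exact measurable_measure_prodMk_left this

theorem measurable_stepMeasure (SI SII : G.Strategy) (k : ℕ) :
    Measurable (G.stepMeasure SI SII k) := by
  classical
  have hm := G.measurable_current k
  unfold stepMeasure
  refine Measurable.ite (hm G.measurableSet_interiorBoard) ?_
    (Measure.measurable_dirac.comp (measurable_const.prodMk hm))
  refine Measure.measurable_of_measurable_coe _ fun A hA => ?_
  have hA' : MeasurableSet (Prod.mk (2 : Fin 3) ⁻¹' A : Set G.Board) :=
    measurable_prodMk_left hA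
  simp only [Measure.coe_add, Measure.coe_smul, Pi.add_apply, Pi.smul_apply, smul_eq_mul]
  refine ((Measurable.const_mul ?_ _).add (Measurable.const_mul ?_ _)).add
    (Measurable.const_mul ?_ _)
  · exact (Measure.measurable_coe hA).comp
      (Measure.measurable_dirac.comp (measurable_const.prodMk (SI.measurable_move k)))
  · exact (Measure.measurable_coe hA).comp
      (Measure.measurable_dirac.comp (measurable_const.prodMk (SII.measurable_move k)))
  · simp only [Measure.map_apply measurable_prodMk_left hA,
      ProbabilityTheory.cond_apply Metric.isOpen_ball.measurableSet]
    refine Measurable.mul (Measurable.inv ?_) ((G.measurable_volume_inter hA').comp hm)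
    have h := (G.measurable_volume_inter MeasurableSet.univ).comp hm
    simp only [Set.inter_univ] at h
    exact h

/-- The transition kernel of the game from time `k` to time `k + 1`. -/
def step (SI SII : G.Strategy) (k : ℕ) : Kernel (G.History k) (G.Stage (k + 1)) where
  toFun := G.stepMeasure SI SII k
  measurable' := G.measurable_stepMeasure SI SII k

instance (SI SII : G.Strategy) (k : ℕ) : IsMarkovKernel (G.step SI SII k) := by
  refine ⟨fun h => ?_⟩
  change IsProbabilityMeasure (G.stepMeasure SI SII k h)
  unfold stepMeasure
  split_ifs with hx
  · have h0 : volume (Metric.ball (G.current h) G.ε) ≠ 0 := by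
      rw [G.volume_ball hx]
      exact (Metric.measure_ball_pos _ _ G.ε_pos).ne'
    have h1 : volume (Metric.ball (G.current h) G.ε) ≠ ⊤ := by
      rw [G.volume_ball hx]
      exact measure_ball_lt_top.ne
    have := ProbabilityTheory.cond_isProbabilityMeasure_of_finite h0 h1
    have := Measure.isProbabilityMeasure_map
      (μ := ProbabilityTheory.cond volume (Metric.ball (G.current h) G.ε))
      (f := Prod.mk (2 : Fin 3)) measurable_prodMk_left.aemeasurable
    constructor
    have hα := G.α_pos
    have hβ := G.β_pos
    simp only [Measure.coe_add, Measure.coe_smul, Pi.add_apply, Pi.smul_apply, smul_eq_mul,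
      measure_univ, mul_one]
    rw [← ENNReal.ofReal_add (by positivity) (by positivity),
      ← ENNReal.ofReal_add (by positivity) (by positivity), add_halves, G.add_eq_one,
      ENNReal.ofReal_one]
  · infer_instance

/-- Infinite runs `(x₀, (c₁, x₁), (c₂, x₂), …)` of the game. -/
abbrev Run : Type := ∀ k, G.Stage k

/-- The history `(x₀)` at the start of the game. -/
def startHistory (x₀ : G.Board) : G.History 0
  | ⟨0, _⟩ => x₀
  | ⟨_ + 1, h⟩ => absurd (Finset.mem_Iic.1 h) (Nat.not_succ_le_zero _)

/-- The law of the run of the game that starts at `x₀`, when the players use the strategies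
`SI` and `SII`: the Ionescu-Tulcea measure with the transition kernels `G.step SI SII k`. -/
def law (SI SII : G.Strategy) (x₀ : G.Board) : Measure G.Run :=
  Kernel.traj (X := G.Stage) (G.step SI SII) 0 (G.startHistory x₀)

/-! ### The value of the game -/

/-- The token leaves `Ω` at some time. -/
def Terminates (ω : G.Run) : Prop := ∃ k, G.pos k (ω k) ∉ G.interiorBoard

open Classical in
/-- The payoff `F(x_τ)`, where `τ` is the first time at which the token is outside `Ω`
(and `0` if the game never ends, which has probability zero). -/
def payoff (F : G.strip → ℝ) (ω : G.Run) : ℝ :=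
  if h : G.Terminates ω then F (G.toStrip (G.pos (Nat.find h) (ω (Nat.find h))) (Nat.find_spec h))
  else 0

/-- The expected payoff. -/
def expectedPayoff (F : G.strip → ℝ) (SI SII : G.Strategy) (x₀ : G.Board) : ℝ :=
  ∫ ω, G.payoff F ω ∂(G.law SI SII x₀)

/-- The value of the game for Player I. -/
def valueI (F : G.strip → ℝ) (x₀ : G.Board) : ℝ :=
  ⨆ SI : G.Strategy, ⨅ SII : G.Strategy, G.expectedPayoff F SI SII x₀

/-- The value of the game for Player II. -/
def valueII (F : G.strip → ℝ) (x₀ : G.Board) : ℝ :=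
  ⨅ SII : G.Strategy, ⨆ SI : G.Strategy, G.expectedPayoff F SI SII x₀

end TugOfWar

end

/-! Existence comes from iteration, uniqueness from the game. `T` is monotone and fixes constants,
so the iterates increase to a bounded Borel limit `u`. Let `m` be the limiting sup distance from
`u_k` to `u`. The tug-of-war terms contract it by the factor `α`; the noise term is at most a
constant times `∫ (u - u_k)`, which tends to `0` by dominated convergence. Hence `m ≤ α m`, so `m =
0`. Uniformity matters, since infima over balls need not commute with increasing pointwise limits;
it makes `u = Tu` (`exists_tendstoUniformly_iter`, `isSolution_of_tendstoUniformly`).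

The game ends almost surely because of the noise alone: for large `L` a random step raises the mean
of `exp (L x_i)` so much that its expectation grows by a fixed amount at each step in `Ω`, while the
function is bounded (`exists_lyapunov`, `ae_terminates`).

Given any solution `u`, Player I moves to points where `u` is within `η / 2^(k+1)` of its supremum
over the ball. Whatever Player II does, the expectation of `u(x_k)` then drops by at most `η` in
total, and it tends to the expected payoff. Player II argues likewise with `-u`. So every solution
equals both values (`IsSolution.eq_value`). The required Borel strategies exist because open balls
allow a Lindelöf argument (`exists_measurable_near_iSup`). -/

noncomputable section

namespace TugOfWar

variable {n : ℕ} (G : TugOfWar n)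

/-! ### Averages over balls -/

theorem mem_ball_self (x : G.Board) : x ∈ Metric.ball x G.ε := Metric.mem_ball_self G.ε_pos

instance (x : G.Board) : Nonempty (Metric.ball x G.ε) := ⟨⟨x, G.mem_ball_self x⟩⟩

/-- The uniform distribution on `B_ε(x)`. -/
def uniform (x : G.Board) : Measure G.Board :=
  ProbabilityTheory.cond volume (Metric.ball x G.ε)

theorem volume_ball_ne_zero {x : G.Board} (hx : x ∈ G.interiorBoard) :
    volume (Metric.ball x G.ε) ≠ 0 := by
  rw [G.volume_ball hx]
  exact (Metric.measure_ball_pos _ _ G.ε_pos).ne'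

theorem isProbabilityMeasure_uniform {x : G.Board} (hx : x ∈ G.interiorBoard) :
    IsProbabilityMeasure (G.uniform x) :=
  ProbabilityTheory.cond_isProbabilityMeasure_of_finite (G.volume_ball_ne_zero hx)
    (measure_ne_top _ _)

theorem setAverage_ball (u : G.Board → ℝ) (x : G.Board) :
    ⨍ y in Metric.ball x G.ε, u y = ∫ y, u y ∂(G.uniform x) := by
  rw [average, uniform, ProbabilityTheory.cond, Measure.restrict_apply_univ]

theorem dppOp_of_mem (u : G.Board → ℝ) {x : G.Board} (hx : x ∈ G.interiorBoard) :
    G.dppOp u x = G.α / 2 * (⨆ y : Metric.ball x G.ε, u y)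
      + G.α / 2 * (⨅ y : Metric.ball x G.ε, u y) + G.β * ∫ y, u y ∂(G.uniform x) := by
  rw [← setAverage_ball, dppOp, if_pos hx]

theorem dppOp_of_notMem (u : G.Board → ℝ) {x : G.Board} (hx : x ∉ G.interiorBoard) :
    G.dppOp u x = u x := by
  rw [dppOp, if_neg hx]

/-! ### Bounded Borel functions -/

/-- Borel functions bounded by `C`. -/
structure BorelBdd (C : ℝ) (u : G.Board → ℝ) : Prop where
  measurable : Measurable u
  abs_le : ∀ x, |u x| ≤ C

variable {G} {C : ℝ} {u v : G.Board → ℝ}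

namespace BorelBdd

theorem le (h : G.BorelBdd C u) (x : G.Board) : u x ≤ C := (_root_.abs_le.1 (h.abs_le x)).2

theorem neg_le (h : G.BorelBdd C u) (x : G.Board) : -C ≤ u x := (_root_.abs_le.1 (h.abs_le x)).1

theorem neg (h : G.BorelBdd C u) : G.BorelBdd C (-u) :=
  ⟨h.measurable.neg, fun x => by simpa using h.abs_le x⟩

theorem bddAbove (h : G.BorelBdd C u) (x : G.Board) :
    BddAbove (Set.range fun y : Metric.ball x G.ε => u y) :=
  ⟨C, by rintro _ ⟨y, rfl⟩; exact h.le y⟩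

theorem bddBelow (h : G.BorelBdd C u) (x : G.Board) :
    BddBelow (Set.range fun y : Metric.ball x G.ε => u y) :=
  ⟨-C, by rintro _ ⟨y, rfl⟩; exact h.neg_le y⟩

theorem integrable_comp {Y : Type*} [MeasurableSpace Y] {μ : Measure Y} [IsFiniteMeasure μ]
    (h : G.BorelBdd C u) {f : Y → G.Board} (hf : Measurable f) :
    Integrable (fun y => u (f y)) μ :=
  .of_bound (h.measurable.comp hf).aestronglyMeasurable C (.of_forall fun y => h.abs_le (f y))

theorem integrable {μ : Measure G.Board} [IsFiniteMeasure μ] (h : G.BorelBdd C u) :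
    Integrable u μ := h.integrable_comp measurable_id

/-- The supremum over balls is lower semicontinuous, hence Borel. -/
theorem measurable_iSup (h : G.BorelBdd C u) :
    Measurable fun x : G.Board => ⨆ y : Metric.ball x G.ε, u y := by
  refine measurable_of_Ioi fun c => IsOpen.measurableSet ?_
  -- By symmetry of the distance, a superlevel set is a union of balls centred where `u` is large.
  have : (fun x : G.Board => ⨆ y : Metric.ball x G.ε, u y) ⁻¹' Set.Ioi c
      = ⋃ y ∈ {y | c < u y}, Metric.ball y G.ε := by
    ext x
    simp only [Set.mem_preimage, Set.mem_Ioi, lt_ciSup_iff (h.bddAbove x), Set.mem_iUnion,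
      Set.mem_ofPred_eq, exists_prop, Subtype.exists, Metric.mem_ball_comm]
    exact exists_congr fun y => exists_congr fun _ => and_comm
  rw [this]
  exact isOpen_biUnion fun _ _ => Metric.isOpen_ball

/-- No boundedness is needed: the real infimum is by definition the negated supremum of the negated
set. -/
theorem iInf_eq_neg_iSup (u : G.Board → ℝ) (x : G.Board) :
    ⨅ y : Metric.ball x G.ε, u y = -⨆ y : Metric.ball x G.ε, (-u) y := by
  simp only [iInf, iSup, Pi.neg_apply, Real.sInf_def, ← Set.image_neg_eq_neg, ← Set.range_comp]
  rfl

theorem measurable_iInf (h : G.BorelBdd C u) :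
    Measurable fun x : G.Board => ⨅ y : Metric.ball x G.ε, u y := by
  simp only [iInf_eq_neg_iSup]
  exact h.neg.measurable_iSup.neg

theorem measurable_setIntegral (h : G.BorelBdd C u) :
    Measurable fun x => ∫ y in Metric.ball x G.ε, u y := by
  have hs : MeasurableSet {p : G.Board × G.Board | dist p.2 p.1 < G.ε} :=
    measurableSet_lt (measurable_snd.dist measurable_fst) measurable_const
  have : StronglyMeasurable fun x => ∫ y,
      {p : G.Board × G.Board | dist p.2 p.1 < G.ε}.indicator (fun p => u p.2) (x, y) :=
    StronglyMeasurable.integral_prod_right'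
      ((h.measurable.comp measurable_snd).indicator hs).stronglyMeasurable
  convert this.measurable using 2 with x
  rw [← integral_indicator Metric.isOpen_ball.measurableSet]
  rfl

/-- Near the outer edge of the strip the balls are truncated, so their volume depends on `x` and the
quotient has two varying terms. -/
theorem measurable_setAverage (h : G.BorelBdd C u) :
    Measurable fun x => ⨍ y in Metric.ball x G.ε, u y := by
  simp only [setAverage_eq, smul_eq_mul, measureReal_def]
  refine Measurable.mul (Measurable.inv (Measurable.ennreal_toReal ?_)) h.measurable_setIntegral
  simpa using G.measurable_volume_inter MeasurableSet.univ

theorem dppOp_mono (hu : G.BorelBdd C u) (hv : G.BorelBdd C v) (huv : ∀ x, u x ≤ v x)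
    (x : G.Board) : G.dppOp u x ≤ G.dppOp v x := by
  have hα := G.α_pos
  have hβ := G.β_pos
  by_cases hx : x ∈ G.interiorBoard
  · have := G.isProbabilityMeasure_uniform hx
    rw [dppOp_of_mem _ _ hx, dppOp_of_mem _ _ hx]
    gcongr ?_ * ?_ + ?_ * ?_ + ?_ * ?_
    · exact ciSup_mono (hv.bddAbove x) fun y => huv y
    · exact ciInf_mono (hu.bddBelow x) fun y => huv y
    · exact integral_mono hu.integrable hv.integrable huv
  · simpa only [dppOp_of_notMem _ _ hx] using huv x

end BorelBdd

theorem borelBdd_const {c : ℝ} (hc : |c| ≤ C) : G.BorelBdd C fun _ => c :=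
  ⟨measurable_const, fun _ => hc⟩

theorem dppOp_const (c : ℝ) (x : G.Board) : G.dppOp (fun _ => c) x = c := by
  by_cases hx : x ∈ G.interiorBoard
  · have := G.isProbabilityMeasure_uniform hx
    rw [dppOp_of_mem _ _ hx, ciSup_const, ciInf_const, integral_const, probReal_univ,
      smul_eq_mul]
    linear_combination c * G.add_eq_one
  · exact dppOp_of_notMem _ _ hx

/-- The bound survives by comparison with the constants `±C`, which `T` fixes. -/
theorem BorelBdd.dppOp (h : G.BorelBdd C u) : G.BorelBdd C (G.dppOp u) := by
  classical
  refine ⟨?_, fun x => _root_.abs_le.2 ⟨?_, ?_⟩⟩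
  · unfold TugOfWar.dppOp
    exact Measurable.ite G.measurableSet_interiorBoard
      (((h.measurable_iSup.const_mul _).add (h.measurable_iInf.const_mul _)).add
        (h.measurable_setAverage.const_mul _)) h.measurable
  · have hC : |-C| ≤ C := by
      rw [abs_neg, abs_of_nonneg ((abs_nonneg _).trans (h.abs_le x))]
    simpa only [dppOp_const] using (borelBdd_const hC).dppOp_mono h h.neg_le x
  · have hC : |C| ≤ C := by rw [abs_of_nonneg ((abs_nonneg _).trans (h.abs_le x))]
    simpa only [dppOp_const] using h.dppOp_mono (borelBdd_const hC) h.le x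

/-- The contraction estimate for the operator `T`: the tug-of-war part contracts the supremum
distance by the factor `α`, and the noise part is controlled by the mean distance. -/
theorem BorelBdd.dppOp_sub_le (hu : G.BorelBdd C u) (hv : G.BorelBdd C v) {M : ℝ}
    (hM : ∀ x, u x - v x ≤ M) {x : G.Board} (hx : x ∈ G.interiorBoard) :
    G.dppOp u x - G.dppOp v x ≤ G.α * M + G.β * ∫ y, (u y - v y) ∂(G.uniform x) := by
  have := G.isProbabilityMeasure_uniform hx
  have hα := G.α_pos
  have h1 : ⨆ y : Metric.ball x G.ε, u y ≤ (⨆ y : Metric.ball x G.ε, v y) + M :=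
    ciSup_le fun y => by linarith [hM y, le_ciSup (hv.bddAbove x) y]
  have h2 : (⨅ y : Metric.ball x G.ε, u y) - M ≤ ⨅ y : Metric.ball x G.ε, v y :=
    le_ciInf fun y => by linarith [hM y, ciInf_le (hu.bddBelow x) y]
  rw [dppOp_of_mem _ _ hx, dppOp_of_mem _ _ hx, integral_sub hu.integrable hv.integrable]
  linarith [mul_le_mul_of_nonneg_left h1 hα.le, mul_le_mul_of_nonneg_left h2 hα.le]

/-! ### The iteration -/

section Iteration

variable {F : G.strip → ℝ}

theorem iterStart_of_mem (F : G.strip → ℝ) {x : G.Board} (hx : x ∈ G.interiorBoard) :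
    G.iterStart F x = ⨅ y, F y := by
  rw [iterStart, dif_pos hx]

theorem iterStart_of_notMem (F : G.strip → ℝ) {x : G.Board} (hx : x ∉ G.interiorBoard) :
    G.iterStart F x = F (G.toStrip x hx) := by
  rw [iterStart, dif_neg hx]

theorem borelBdd_iterStart (hF : Measurable F) (hC : 0 ≤ C) (hFC : ∀ y, |F y| ≤ C) :
    G.BorelBdd C (G.iterStart F) := by
  classical
  refine ⟨?_, fun x => ?_⟩
  · unfold iterStart
    refine Measurable.dite (s := G.interiorBoard) (f := fun _ => ⨅ y, F y)
      (g := fun x => F (G.toStrip x.1 x.2)) measurable_const (hF.comp ?_)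
      G.measurableSet_interiorBoard
    exact ((measurable_subtype_coe.comp measurable_subtype_coe).subtype_mk)
  · by_cases hx : x ∈ G.interiorBoard
    · rw [iterStart_of_mem F hx]
      -- For `n = 0` the strip is empty and the infimum takes the default value `0`; this case uses
      -- `0 ≤ C`.
      rcases isEmpty_or_nonempty G.strip with h | h
      · simpa [Real.iInf_of_isEmpty] using hC
      · refine abs_le.2 ⟨le_ciInf fun y => (abs_le.1 (hFC y)).1, ?_⟩
        exact (ciInf_le ⟨-C, by rintro _ ⟨y, rfl⟩; exact (abs_le.1 (hFC y)).1⟩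
          (Classical.arbitrary _)).trans (abs_le.1 (hFC _)).2
    · rw [iterStart_of_notMem F hx]
      exact hFC _

theorem iter_succ (F : G.strip → ℝ) (j : ℕ) : G.iter F (j + 1) = G.dppOp (G.iter F j) :=
  Function.iterate_succ_apply' _ _ _

theorem iter_of_notMem (F : G.strip → ℝ) (j : ℕ) {x : G.Board} (hx : x ∉ G.interiorBoard) :
    G.iter F j x = F (G.toStrip x hx) := by
  induction j with
  | zero => exact iterStart_of_notMem F hx
  | succ j ih => rw [iter_succ, dppOp_of_notMem _ _ hx, ih]

theorem borelBdd_iter (hF : Measurable F) (hC : 0 ≤ C) (hFC : ∀ y, |F y| ≤ C) (j : ℕ) :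
    G.BorelBdd C (G.iter F j) := by
  induction j with
  | zero => exact borelBdd_iterStart hF hC hFC
  | succ j ih => rw [iter_succ]; exact ih.dppOp

/-- The start lies above the constant `inf F`, which `T` fixes, and equals it in `Ω`; monotonicity
of `T` propagates the first inequality. -/
theorem iter_le_succ (hF : Measurable F) (hC : 0 ≤ C) (hFC : ∀ y, |F y| ≤ C) (j : ℕ)
    (x : G.Board) : G.iter F j x ≤ G.iter F (j + 1) x := by
  have hb := borelBdd_iter hF hC hFC
  induction j generalizing x with
  | zero =>
    rw [iter_succ]
    change G.iterStart F x ≤ G.dppOp (G.iterStart F) x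
    by_cases hx : x ∈ G.interiorBoard
    · have hc : ∀ y, ⨅ z, F z ≤ G.iterStart F y := fun y => by
        by_cases hy : y ∈ G.interiorBoard
        · rw [iterStart_of_mem F hy]
        · rw [iterStart_of_notMem F hy]
          exact ciInf_le ⟨-C, by rintro _ ⟨y, rfl⟩; exact (abs_le.1 (hFC y)).1⟩ _
      have h0 : |⨅ z, F z| ≤ C := by
        rw [← iterStart_of_mem F hx]
        exact (hb 0).abs_le x
      rw [iterStart_of_mem F hx]
      have := (borelBdd_const h0).dppOp_mono (hb 0) hc x
      rwa [dppOp_const] at this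
    · rw [dppOp_of_notMem _ _ hx]
  | succ j ih =>
    rw [iter_succ, iter_succ F (j + 1)]
    exact (hb j).dppOp_mono (hb (j + 1)) ih x

/-- The volume of a ball of radius `ε` in `ℝⁿ`. -/
def ballVolume (G : TugOfWar n) : ℝ :=
  (volume (Metric.ball (0 : EuclideanSpace ℝ (Fin n)) G.ε)).toReal

theorem ballVolume_pos : 0 < G.ballVolume :=
  ENNReal.toReal_pos (Metric.measure_ball_pos _ _ G.ε_pos).ne' measure_ball_lt_top.ne

theorem integral_uniform {x : G.Board} (hx : x ∈ G.interiorBoard) (u : G.Board → ℝ) :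
    ∫ y, u y ∂(G.uniform x) = G.ballVolume⁻¹ * ∫ y in Metric.ball x G.ε, u y := by
  rw [uniform, ProbabilityTheory.cond, integral_smul_measure, G.volume_ball hx,
    Measure.addHaar_ball_center, ENNReal.toReal_inv, smul_eq_mul, ballVolume]

/-- The right side does not depend on `x`: convergence in mean controls the noise term uniformly. -/
theorem integral_uniform_le {x : G.Board} (hx : x ∈ G.interiorBoard) (hu : Integrable u)
    (h0 : ∀ y, 0 ≤ u y) : ∫ y, u y ∂(G.uniform x) ≤ G.ballVolume⁻¹ * ∫ y, u y := by
  rw [integral_uniform hx]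
  exact mul_le_mul_of_nonneg_left (setIntegral_le_integral hu (.of_forall h0))
    (inv_nonneg.2 ballVolume_pos.le)

/-- The iterates converge uniformly to a bounded Borel function. -/
theorem exists_tendstoUniformly_iter (hF : Measurable F) (hC : 0 ≤ C) (hFC : ∀ y, |F y| ≤ C) :
    ∃ u, G.BorelBdd C u ∧ TendstoUniformly (G.iter F) u atTop := by
  have hb := borelBdd_iter hF hC hFC
  have hmono : ∀ x, Monotone fun j => G.iter F j x := fun x =>
    monotone_nat_of_le_succ fun j => iter_le_succ hF hC hFC j x
  have hbdd : ∀ x, BddAbove (Set.range fun j => G.iter F j x) := fun x =>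
    ⟨C, by rintro _ ⟨j, rfl⟩; exact (hb j).le x⟩
  set u : G.Board → ℝ := fun x => ⨆ j, G.iter F j x with hu
  have hlim : ∀ x, Tendsto (fun j => G.iter F j x) atTop (𝓝 (u x)) := fun x =>
    tendsto_atTop_ciSup (hmono x) (hbdd x)
  have hle : ∀ j x, G.iter F j x ≤ u x := fun j x => le_ciSup (hbdd x) j
  have hub : G.BorelBdd C u :=
    ⟨measurable_of_tendsto_metrizable (fun j => (hb j).measurable) (tendsto_pi_nhds.2 hlim),
      fun x => abs_le.2 ⟨((hb 0).neg_le x).trans (hle 0 x), ciSup_le fun j => (hb j).le x⟩⟩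
  refine ⟨u, hub, ?_⟩
  have hint : Tendsto (fun k => ∫ y, (u y - G.iter F k y)) atTop (𝓝 0) := by
    have := tendsto_integral_of_dominated_convergence (μ := (volume : Measure G.Board))
      (F := fun k y => u y - G.iter F k y) (f := fun _ => 0) (fun _ => 2 * C)
      (fun k => (hub.measurable.sub (hb k).measurable).aestronglyMeasurable)
      (integrable_const _)
      (fun k => .of_forall fun y => by
        rw [Real.norm_eq_abs, abs_le]
        constructor <;> linarith [hub.le y, hub.neg_le y, (hb k).le y, (hb k).neg_le y])
      (.of_forall fun y => by simpa using (hlim y).const_sub (u y))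
    simpa using this
  -- The uniform error bounds attained by some iterate. `S` is stable under `M ↦ α M + δ`, which
  -- forces its infimum to be `0`.
  let S : Set ℝ := {M | 0 ≤ M ∧ ∃ k, ∀ x, u x - G.iter F k x ≤ M}
  have hS0 : 2 * C ∈ S := ⟨by positivity, 0, fun x => by linarith [hub.le x, (hb 0).neg_le x]⟩
  have hSb : BddBelow S := ⟨0, fun M hM => hM.1⟩
  have hstep : ∀ M ∈ S, ∀ δ > 0, G.α * M + δ ∈ S := by
    rintro M ⟨hM, k₀, hk₀⟩ δ hδ
    have hα := G.α_pos
    have hβ := G.β_pos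
    have hc : Tendsto (fun k => G.β * (G.ballVolume⁻¹ * ∫ y, (u y - G.iter F k y))) atTop (𝓝 0) := by
      simpa using (hint.const_mul G.ballVolume⁻¹).const_mul G.β
    obtain ⟨k, hk, hkk₀⟩ := ((hc.eventually (gt_mem_nhds hδ)).and (eventually_ge_atTop k₀)).exists
    refine ⟨by positivity, k + 1, fun x => ?_⟩
    by_cases hx : x ∈ G.interiorBoard
    · have := G.isProbabilityMeasure_uniform hx
      -- `u = Tu` is not yet known, so `u` is replaced by `u_{l+1} = T u_l`, and `l → ∞` at the end.
      refine le_of_tendsto (((hlim x).comp (tendsto_add_atTop_nat 1)).sub_const _)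
        (.of_forall fun l => ?_)
      simp only [Function.comp_apply, iter_succ]
      refine ((hb l).dppOp_sub_le (hb k) (M := M) (fun y => ?_) hx).trans ?_
      · linarith [hle l y, hk₀ y, hmono y hkk₀]
      · have h1 : ∫ y, (G.iter F l y - G.iter F k y) ∂(G.uniform x)
            ≤ ∫ y, (u y - G.iter F k y) ∂(G.uniform x) :=
          integral_mono ((hb l).integrable.sub (hb k).integrable)
            (hub.integrable.sub (hb k).integrable) fun y => by
              simpa using hle l y
        have h2 := integral_uniform_le hx (hub.integrable.sub (hb k).integrable)
          fun y => sub_nonneg.2 (hle k y)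
        have h3 := mul_le_mul_of_nonneg_left (h1.trans h2) hβ.le
        simp only [Pi.sub_apply] at h3
        linarith
    · have : u x - G.iter F (k + 1) x = 0 := by
        simp only [hu, iter_of_notMem F _ hx, ciSup_const, sub_self]
      rw [this]
      positivity
  have hinf : sInf S = 0 := by
    have h0 : 0 ≤ sInf S := le_csInf ⟨_, hS0⟩ fun M hM => hM.1
    have h1 : sInf S ≤ G.α * sInf S := by
      refine le_of_forall_pos_le_add fun δ hδ => ?_
      have hα := G.α_pos
      obtain ⟨M, hM, hlt⟩ := exists_lt_of_csInf_lt ⟨_, hS0⟩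
        (lt_add_of_pos_right (sInf S) (half_pos hδ))
      have h2 := csInf_le hSb (hstep M hM (δ / 2) (half_pos hδ))
      nlinarith [G.add_eq_one, G.β_pos]
    nlinarith [G.add_eq_one, G.β_pos]
  rw [Metric.tendstoUniformly_iff]
  intro δ hδ
  obtain ⟨M, ⟨hM, k, hk⟩, hlt⟩ := exists_lt_of_csInf_lt ⟨_, hS0⟩ (hinf.symm ▸ hδ : sInf S < δ)
  filter_upwards [eventually_ge_atTop k] with j hj x
  rw [Real.dist_eq, abs_of_nonneg (sub_nonneg.2 (hle j x))]
  linarith [hk x, hmono x hj]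

/-- The uniform limit of the iterates solves the dynamic programming principle. -/
theorem isSolution_of_tendstoUniformly (hF : Measurable F) (hC : 0 ≤ C) (hFC : ∀ y, |F y| ≤ C)
    (hu : G.BorelBdd C u) (h : TendstoUniformly (G.iter F) u atTop) : G.IsSolution F u := by
  have hb := borelBdd_iter hF hC hFC
  refine ⟨hu.measurable, ⟨C, hu.abs_le⟩, funext fun x => ?_, fun y => ?_⟩
  · have h1 : Tendsto (fun j => G.dppOp (G.iter F j) x) atTop (𝓝 (u x)) := by
      simpa only [Function.comp_def, iter_succ] using
        (h.tendsto_at x).comp (tendsto_add_atTop_nat 1)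
    refine tendsto_nhds_unique h1 ?_
    by_cases hx : x ∈ G.interiorBoard
    · have := G.isProbabilityMeasure_uniform hx
      -- `T` is nonexpansive for the one-sided sup distance, because `α + β = 1`; it is used in both
      -- directions.
      have key : ∀ {v w : G.Board → ℝ} {δ : ℝ}, G.BorelBdd C v → G.BorelBdd C w →
          (∀ y, v y - w y ≤ δ) → G.dppOp v x - G.dppOp w x ≤ δ := fun {v w δ} hv hw hvw => by
        have h2 : ∫ y, (v y - w y) ∂(G.uniform x) ≤ δ := by
          simpa using integral_mono (μ := G.uniform x) (hv.integrable.sub hw.integrable)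
            (integrable_const δ) hvw
        have h3 := hv.dppOp_sub_le hw hvw hx
        have h4 := mul_le_mul_of_nonneg_left h2 G.β_pos.le
        have h5 : G.α * δ + G.β * δ = δ := by rw [← add_mul, G.add_eq_one, one_mul]
        linarith
      rw [Metric.tendsto_atTop]
      intro δ hδ
      obtain ⟨N, hN⟩ := eventually_atTop.1 (Metric.tendstoUniformly_iff.1 h (δ / 2) (half_pos hδ))
      refine ⟨N, fun j hj => ?_⟩
      have h6 := fun y => abs_lt.1 (Real.dist_eq _ _ ▸ hN j hj y)
      refine (abs_le.2 ⟨?_, ?_⟩ : |_| ≤ δ / 2).trans_lt (half_lt_self hδ)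
      · linarith [key hu (hb j) fun y => (h6 y).2.le]
      · exact key (hb j) hu fun y => by linarith [(h6 y).1]
    · simpa only [dppOp_of_notMem _ _ hx] using h.tendsto_at x
  · have hy : G.ofStrip y ∉ G.interiorBoard := y.2.1
    refine tendsto_nhds_unique (h.tendsto_at _) ?_
    simp only [iter_of_notMem F _ hy]
    exact tendsto_const_nhds

end Iteration

/-! ### Borel selection of almost optimal moves -/

instance : Nonempty G.Board :=
  let ⟨x, hx⟩ := G.isConnected.nonempty
  ⟨⟨x, Or.inr hx⟩⟩

/-- Points of the ball around `x` at which a bounded Borel function almost attains its supremum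
over the ball can be chosen in a Borel way, with countably many values. -/
theorem BorelBdd.exists_measurable_near_iSup (h : G.BorelBdd C u) {η : ℝ} (hη : 0 < η) :
    ∃ s : G.Board → G.Board, Measurable s ∧ ∀ x, s x ∈ Metric.ball x G.ε ∧
      (⨆ y : Metric.ball x G.ε, u y) - η ≤ u (s x) := by
  -- Lindelöf: for each rational `q`, countably many points with `u > q` have balls covering as much
  -- as all such points.
  have hcover : ∀ q : ℚ, ∃ t : Set {y : G.Board // q < u y}, t.Countable ∧
      ⋃ y ∈ t, Metric.ball (y : G.Board) G.ε
        = ⋃ y : {y : G.Board // q < u y}, Metric.ball (y : G.Board) G.ε := fun q =>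
    eq_open_union_countable _ fun _ => Metric.isOpen_ball
  choose t htc ht using hcover
  obtain ⟨d, hd⟩ : ∃ d : ℕ → G.Board, ∀ q, ∀ y ∈ t q, ∃ k, d k = y := by
    have hc : (⋃ q, Subtype.val '' t q : Set G.Board).Countable :=
      Set.countable_iUnion fun q => (htc q).image _
    -- The extra point makes the countable set nonempty, so that it is the range of a sequence.
    obtain ⟨d, hd⟩ := (hc.union (Set.countable_singleton (Classical.arbitrary G.Board))).exists_eq_range
      ⟨_, Or.inr rfl⟩
    refine ⟨d, fun q y hy => ?_⟩
    have : (y : G.Board) ∈ Set.range d :=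
      hd ▸ Or.inl (Set.mem_iUnion.2 ⟨q, Set.mem_image_of_mem _ hy⟩)
    exact this
  have hex : ∀ x : G.Board, ∃ k, d k ∈ Metric.ball x G.ε ∧
      (⨆ y : Metric.ball x G.ε, u y) - η < u (d k) := fun x => by
    obtain ⟨q, hq1, hq2⟩ := exists_rat_btwn (sub_lt_self (⨆ y : Metric.ball x G.ε, u y) hη)
    obtain ⟨y, hy⟩ := (lt_ciSup_iff (h.bddAbove x)).1 hq2
    have hx : x ∈ ⋃ y ∈ t q, Metric.ball (y : G.Board) G.ε := by
      rw [ht]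
      exact Set.mem_iUnion.2 ⟨⟨y, hy⟩, Metric.mem_ball_comm.1 y.2⟩
    obtain ⟨z, hz, hxz⟩ := Set.mem_iUnion₂.1 hx
    obtain ⟨k, hk⟩ := hd q z hz
    exact ⟨k, hk ▸ Metric.mem_ball_comm.1 hxz, hk ▸ hq1.trans z.2⟩
  have hmeas : ∀ k, MeasurableSet {x : G.Board | d k ∈ Metric.ball x G.ε ∧
      (⨆ y : Metric.ball x G.ε, u y) - η < u (d k)} := fun k => by
    have hb : {x : G.Board | d k ∈ Metric.ball x G.ε} = Metric.ball (d k) G.ε := by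
      ext x
      rw [Set.mem_ofPred_eq, Metric.mem_ball_comm]
    have h1 : MeasurableSet {x : G.Board | d k ∈ Metric.ball x G.ε} := by
      rw [hb]
      exact Metric.isOpen_ball.measurableSet
    have h2 : Measurable fun x : G.Board => (⨆ y : Metric.ball x G.ε, u y) - η :=
      h.measurable_iSup.sub_const η
    have h3 : MeasurableSet {x : G.Board | (⨆ y : Metric.ball x G.ε, u y) - η < u (d k)} :=
      measurableSet_lt h2 measurable_const
    exact h1.inter h3
  classical
  -- Taking the first admissible index makes the choice Borel.
  exact ⟨fun x => d (Nat.find (hex x)), Measurable.find (f := fun k (_ : G.Board) => d k)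
    (fun k => measurable_const) hmeas hex,
    fun x => ⟨(Nat.find_spec (hex x)).1, (Nat.find_spec (hex x)).2.le⟩⟩

/-- The strategy that moves from the position `x` at time `k` to `s k x`. -/
def Strategy.ofPositions (s : ℕ → G.Board → G.Board) (hs : ∀ k, Measurable (s k))
    (hmem : ∀ k x, s k x ∈ Metric.ball x G.ε) : G.Strategy where
  move k h := s k (G.current h)
  measurable_move k := (hs k).comp (G.measurable_current k)
  move_mem k _ _ := hmem k _

instance : Nonempty G.Strategy :=
  ⟨.ofPositions (fun _ => id) (fun _ => measurable_id) fun _ => G.mem_ball_self⟩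

/-- The tolerance depends on time so that the total loss over an infinite run can be made small. -/
theorem BorelBdd.exists_strategy_near_iSup (hu : G.BorelBdd C u) {e : ℕ → ℝ} (he : ∀ k, 0 < e k) :
    ∃ S : G.Strategy, ∀ k (h : G.History k),
      (⨆ y : Metric.ball (G.current h) G.ε, u y) - e k ≤ u (S.move k h) := by
  choose s hs hmem using fun k => hu.exists_measurable_near_iSup (he k)
  exact ⟨.ofPositions s hs fun k x => (hmem k x).1, fun k _ => (hmem k _).2⟩

theorem BorelBdd.exists_strategy_near_iInf (hu : G.BorelBdd C u) {e : ℕ → ℝ} (he : ∀ k, 0 < e k) :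
    ∃ S : G.Strategy, ∀ k (h : G.History k),
      u (S.move k h) ≤ (⨅ y : Metric.ball (G.current h) G.ε, u y) + e k := by
  obtain ⟨S, hS⟩ := hu.neg.exists_strategy_near_iSup he
  refine ⟨S, fun k h => ?_⟩
  have hle := hS k h
  rw [BorelBdd.iInf_eq_neg_iSup u]
  rw [Pi.neg_apply] at hle
  linarith

/-! ### The position after one step -/

section Law

variable {SI SII : G.Strategy} {x₀ : G.Board}

instance : IsProbabilityMeasure (G.law SI SII x₀) := by
  unfold law
  infer_instance

theorem measurable_pos_apply (k : ℕ) : Measurable fun ω : G.Run => G.pos k (ω k) :=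
  (G.measurable_pos k).comp (measurable_pi_apply k)

theorem integral_stepMeasure (hu : G.BorelBdd C u) {k : ℕ} {h : G.History k}
    (hx : G.current h ∈ G.interiorBoard) :
    ∫ s, u s.2 ∂(G.stepMeasure SI SII k h)
      = G.α / 2 * u (SI.move k h) + G.α / 2 * u (SII.move k h)
        + G.β * ∫ y, u y ∂(G.uniform (G.current h)) := by
  have := G.isProbabilityMeasure_uniform hx
  have hα := G.α_pos
  have hβ := G.β_pos
  have hm : StronglyMeasurable fun s : Fin 3 × G.Board => u s.2 :=
    (hu.measurable.comp measurable_snd).stronglyMeasurable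
  have hi : ∀ μ : Measure (Fin 3 × G.Board), IsFiniteMeasure μ →
      Integrable (fun s => u s.2) μ := fun μ _ => hu.integrable_comp measurable_snd
  have hmap : IsFiniteMeasure ((G.uniform (G.current h)).map (Prod.mk (2 : Fin 3))) :=
    inferInstance
  rw [stepMeasure, if_pos hx]
  change ∫ s, u s.2 ∂(_ + _ + ENNReal.ofReal G.β •
    (G.uniform (G.current h)).map (Prod.mk (2 : Fin 3))) = _
  have h1 := (hi (.dirac (0, SI.move k h)) inferInstance).smul_measure
    (ENNReal.ofReal_ne_top (r := G.α / 2))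
  have h2 := (hi (.dirac (1, SII.move k h)) inferInstance).smul_measure
    (ENNReal.ofReal_ne_top (r := G.α / 2))
  rw [integral_add_measure (h1.add_measure h2)
      ((hi _ hmap).smul_measure ENNReal.ofReal_ne_top), integral_add_measure h1 h2]
  simp only [integral_smul_measure, smul_eq_mul, ENNReal.toReal_ofReal (half_pos hα).le,
    ENNReal.toReal_ofReal hβ.le, integral_dirac' _ _ hm]
  rw [integral_map measurable_prodMk_left.aemeasurable hm.aestronglyMeasurable]

/-- This stands in for conditional expectations: with `map_law_frestrictLe` it reduces expectations
at time `k + 1` to one step of the kernel after a random history. -/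
theorem map_law_succ (k : ℕ) :
    (G.law SI SII x₀).map (fun ω => (Preorder.frestrictLe k ω, ω (k + 1)))
      = (Kernel.partialTraj (X := G.Stage) (G.step SI SII) 0 k (G.startHistory x₀))
          ⊗ₘ (G.step SI SII k) :=
  (Kernel.partialTraj_compProd_eq_map_traj (X := G.Stage) k.zero_le).symm

theorem map_law_frestrictLe (k : ℕ) :
    (G.law SI SII x₀).map (Preorder.frestrictLe k)
      = Kernel.partialTraj (X := G.Stage) (G.step SI SII) 0 k (G.startHistory x₀) :=
  Kernel.traj_map_frestrictLe_apply 0 k _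

theorem integral_pos_succ (hu : G.BorelBdd C u) (k : ℕ) :
    ∫ ω, u (G.pos (k + 1) (ω (k + 1))) ∂(G.law SI SII x₀)
      = ∫ ω, (∫ s, u s.2 ∂(G.stepMeasure SI SII k (Preorder.frestrictLe k ω)))
          ∂(G.law SI SII x₀) := by
  have hm : Measurable fun p : G.History k × G.Stage (k + 1) => G.pos (k + 1) p.2 :=
    (G.measurable_pos (k + 1)).comp measurable_snd
  have hm' : Measurable fun ω : G.Run => (Preorder.frestrictLe k ω, ω (k + 1)) :=
    (Preorder.measurable_frestrictLe k).prodMk (measurable_pi_apply _)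
  have h1 := integral_map (μ := G.law SI SII x₀) hm'.aemeasurable
    (f := fun p => u (G.pos (k + 1) p.2)) (hu.measurable.comp hm).aestronglyMeasurable
  rw [map_law_succ, Measure.integral_compProd (hu.integrable_comp hm),
    ← map_law_frestrictLe, integral_map (Preorder.measurable_frestrictLe k).aemeasurable] at h1
  · exact h1.symm
  · exact ((hu.measurable.comp hm).stronglyMeasurable.integral_kernel_prod_right'
      (κ := G.step SI SII k)).aestronglyMeasurable

/-- If `v` lies below the expected value of `u` after one step from each position in `Ω`, and
below `u` outside `Ω`, then the expected values of `v` and `u` are ordered likewise along the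
game. -/
theorem integral_pos_le_integral_pos_succ {D : ℝ} (hu : G.BorelBdd C u) (hv : G.BorelBdd D v)
    (k : ℕ) (hin : ∀ h : G.History k, G.current h ∈ G.interiorBoard →
      v (G.current h) ≤ G.α / 2 * u (SI.move k h) + G.α / 2 * u (SII.move k h)
        + G.β * ∫ y, u y ∂(G.uniform (G.current h)))
    (hout : ∀ x ∉ G.interiorBoard, v x ≤ u x) :
    ∫ ω, v (G.pos k (ω k)) ∂(G.law SI SII x₀)
      ≤ ∫ ω, u (G.pos (k + 1) (ω (k + 1))) ∂(G.law SI SII x₀) := by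
  rw [integral_pos_succ hu]
  refine integral_mono (hv.integrable_comp (measurable_pos_apply k)) ?_ fun ω => ?_
  · refine .of_bound (C := C) ?_ (.of_forall fun ω => ?_)
    · exact (((hu.measurable.comp measurable_snd).stronglyMeasurable.integral_kernel
        (κ := G.step SI SII k)).comp_measurable
          (Preorder.measurable_frestrictLe k)).aestronglyMeasurable
    · have : IsProbabilityMeasure (G.stepMeasure SI SII k (Preorder.frestrictLe k ω)) :=
        inferInstanceAs (IsProbabilityMeasure (G.step SI SII k (Preorder.frestrictLe k ω)))
      simpa using norm_integral_le_of_norm_le_const (μ := G.stepMeasure SI SII k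
        (Preorder.frestrictLe k ω)) (f := fun s => u s.2) (.of_forall fun s => hu.abs_le s.2)
  · change v (G.current (Preorder.frestrictLe k ω)) ≤ _
    by_cases hx : G.current (Preorder.frestrictLe (π := G.Stage) k ω) ∈ G.interiorBoard
    · exact (hin _ hx).trans_eq (integral_stepMeasure hu hx).symm
    · refine (hout _ hx).trans_eq ?_
      rw [stepMeasure, if_neg hx]
      exact (integral_dirac' (fun s : Fin 3 × G.Board => u s.2)
        (2, G.current (Preorder.frestrictLe (π := G.Stage) k ω))
        (hu.measurable.comp measurable_snd).stronglyMeasurable).symm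

/-- Almost surely the token does not move any more once it has left `Ω`. -/
theorem ae_pos_succ_eq : ∀ᵐ ω ∂(G.law SI SII x₀), ∀ k, G.pos k (ω k) ∉ G.interiorBoard →
    G.pos (k + 1) (ω (k + 1)) = G.pos k (ω k) := by
  refine ae_all_iff.2 fun k => ?_
  have hm' : Measurable fun ω : G.Run => (Preorder.frestrictLe k ω, ω (k + 1)) :=
    (Preorder.measurable_frestrictLe k).prodMk (measurable_pi_apply _)
  have hs : MeasurableSet {p : G.History k × G.Stage (k + 1) |
      G.current p.1 ∉ G.interiorBoard → G.pos (k + 1) p.2 = G.current p.1} := by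
    have h1 : Measurable fun p : G.History k × G.Stage (k + 1) => G.current p.1 :=
      (G.measurable_current k).comp measurable_fst
    have h2 : Measurable fun p : G.History k × G.Stage (k + 1) => G.pos (k + 1) p.2 :=
      (G.measurable_pos (k + 1)).comp measurable_snd
    exact (h1 G.measurableSet_interiorBoard).compl.imp (measurableSet_eq_fun h2 h1)
  have key : ∀ᵐ p ∂((G.law SI SII x₀).map
      (fun ω => (Preorder.frestrictLe k ω, ω (k + 1)))),
      G.current p.1 ∉ G.interiorBoard → G.pos (k + 1) p.2 = G.current p.1 := by
    rw [map_law_succ]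
    refine (Measure.ae_compProd_iff hs).2 (.of_forall fun h => ?_)
    change ∀ᵐ s ∂(G.stepMeasure SI SII k h), _
    by_cases hx : G.current h ∈ G.interiorBoard
    · exact .of_forall fun s hs => absurd hx hs
    · rw [stepMeasure, if_neg hx]
      exact (ae_dirac_iff (measurable_prodMk_left hs)).2 fun _ => rfl
  exact ae_of_ae_map hm'.aemeasurable key

end Law

/-! ### An exponential Lyapunov function -/

theorem isBounded_extended : Bornology.IsBounded G.extended := by
  refine (G.isBounded.cthickening (δ := G.ε)).subset fun x hx => ?_
  rw [Metric.mem_cthickening_iff,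
    ENNReal.le_ofReal_iff_toReal_le (Metric.infEDist_ne_top G.isConnected.nonempty) G.ε_pos.le]
  change Metric.infDist x G.Ω ≤ G.ε
  rcases hx with hx | hx
  · exact hx.2
  · simpa [Metric.infDist_zero_of_mem hx] using G.ε_pos.le

/-- The part of `B_ε(x)` in which a given coordinate exceeds that of `x` by more than `ε / 2` is
a fixed positive fraction of the ball. -/
theorem exists_le_uniform_coord (i : Fin n) : ∃ κ > 0, ∀ x ∈ G.interiorBoard,
    κ ≤ (G.uniform x).real {y | x.1 i + G.ε / 2 ≤ y.1 i} := by
  have hε := G.ε_pos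
  refine ⟨G.ballVolume⁻¹ *
    (volume (Metric.ball (0 : EuclideanSpace ℝ (Fin n)) (G.ε / 4))).toReal,
    mul_pos (inv_pos.2 ballVolume_pos) (ENNReal.toReal_pos
      (Metric.measure_ball_pos _ _ (by positivity)).ne' measure_ball_lt_top.ne), fun x hx => ?_⟩
  have := G.isProbabilityMeasure_uniform hx
  -- The ball of radius `ε / 4` about `c` touches the sphere of `B_ε(x)` from inside, and its `i`-th
  -- coordinates exceed `x_i + ε / 2`.
  let c : EuclideanSpace ℝ (Fin n) := x.1 + EuclideanSpace.single i (3 / 4 * G.ε)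
  have hcx : dist c x.1 = 3 / 4 * G.ε := by
    simp [c, dist_eq_norm, abs_of_pos hε]
  have hball : Metric.ball c (G.ε / 4) ⊆ Metric.ball x.1 G.ε :=
    Metric.ball_subset_ball' (by rw [hcx]; linarith)
  let A : Set G.Board := Subtype.val ⁻¹' Metric.ball c (G.ε / 4)
  have hA : MeasurableSet A := measurable_subtype_coe Metric.isOpen_ball.measurableSet
  have hAx : A ⊆ Metric.ball x G.ε := fun y hy => hball hy
  have hAs : A ⊆ {y : G.Board | x.1 i + G.ε / 2 ≤ y.1 i} := fun y hy => by
    have h1 : ‖(y.1 - c) i‖ < G.ε / 4 :=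
      (PiLp.norm_apply_le (y.1 - c) i).trans_lt (by rw [← dist_eq_norm]; exact hy)
    have h2 : c i = x.1 i + 3 / 4 * G.ε := by simp [c]
    rw [PiLp.sub_apply, h2, Real.norm_eq_abs, abs_lt] at h1
    change x.1 i + G.ε / 2 ≤ y.1 i
    linarith [h1.1]
  have hvol : volume A = volume (Metric.ball (0 : EuclideanSpace ℝ (Fin n)) (G.ε / 4)) := by
    rw [Measure.Subtype.volume_def, comap_subtype_coe_apply G.measurableSet_extended,
      Subtype.image_preimage_coe, Set.inter_eq_right.2
        (hball.trans (G.ball_subset_extended hx)), Measure.addHaar_ball_center]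
  refine le_trans (le_of_eq ?_) (measureReal_mono hAs)
  rw [measureReal_def, uniform, ProbabilityTheory.cond_apply Metric.isOpen_ball.measurableSet,
    Set.inter_eq_right.2 hAx, hvol, G.volume_ball hx,
    Measure.addHaar_ball_center volume x.1, ENNReal.toReal_mul, ENNReal.toReal_inv, ballVolume]

/-- There is a bounded nonnegative Borel function whose mean over the balls grows so much, due to
the noise alone, that its expected value increases by a fixed amount at each step in `Ω`. -/
theorem exists_lyapunov (hn : 1 ≤ n) (G : TugOfWar n) : ∃ (C δ : ℝ) (φ : G.Board → ℝ),
    G.BorelBdd C φ ∧ 0 < δ ∧ (∀ x, 0 ≤ φ x) ∧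
      ∀ x ∈ G.interiorBoard, φ x + δ ≤ G.β * ∫ y, φ y ∂(G.uniform x) := by
  have hε := G.ε_pos
  have hβ := G.β_pos
  let i : Fin n := ⟨0, hn⟩
  obtain ⟨κ, hκ, hκx⟩ := exists_le_uniform_coord (G := G) i
  obtain ⟨R, hR⟩ := (isBounded_extended (G := G)).exists_norm_le
  have hRi : ∀ x : G.Board, |x.1 i| ≤ R := fun x => (PiLp.norm_apply_le x.1 i).trans (hR _ x.2)
  -- With this `L` the noise term is at least `2 φ(x)`; the surplus `φ(x)` is bounded below by `δ =
  -- exp (-(L R))`.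
  obtain ⟨L, hL, hLκ⟩ : ∃ L : ℝ, 0 < L ∧ 2 ≤ G.β * (κ * Real.exp (L * (G.ε / 2))) := by
    refine ⟨2 / (G.β * κ) / (G.ε / 2), by positivity, ?_⟩
    rw [div_mul_cancel₀ _ (by positivity)]
    have h1 : 2 / (G.β * κ) ≤ Real.exp (2 / (G.β * κ)) := by
      linarith [Real.add_one_le_exp (2 / (G.β * κ))]
    calc (2 : ℝ) = G.β * (κ * (2 / (G.β * κ))) := by field_simp
      _ ≤ _ := by gcongr
  let φ : G.Board → ℝ := fun x => Real.exp (L * x.1 i)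
  have hφ : G.BorelBdd (Real.exp (L * R)) φ := by
    refine ⟨?_, fun x => ?_⟩
    · refine Continuous.measurable ?_
      fun_prop
    · rw [Real.abs_exp]
      exact Real.exp_le_exp.2 (mul_le_mul_of_nonneg_left (abs_le.1 (hRi x)).2 hL.le)
  refine ⟨_, Real.exp (-(L * R)), φ, hφ, Real.exp_pos _, fun x => (Real.exp_pos _).le,
    fun x hx => ?_⟩
  have := G.isProbabilityMeasure_uniform hx
  have h1 : Real.exp (-(L * R)) ≤ φ x :=
    Real.exp_le_exp.2 (by nlinarith [(abs_le.1 (hRi x)).1])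
  let A : Set G.Board := {y | x.1 i + G.ε / 2 ≤ y.1 i}
  have hA : MeasurableSet A := (isClosed_le continuous_const (by fun_prop)).measurableSet
  have h2 : κ * (φ x * Real.exp (L * (G.ε / 2))) ≤ ∫ y, φ y ∂(G.uniform x) := calc
    _ ≤ (G.uniform x).real A * (φ x * Real.exp (L * (G.ε / 2))) :=
      mul_le_mul_of_nonneg_right (hκx x hx) (by positivity)
    _ = ∫ y, A.indicator (fun _ => φ x * Real.exp (L * (G.ε / 2))) y ∂(G.uniform x) := by
      rw [integral_indicator_const _ hA, smul_eq_mul]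
    _ ≤ _ := by
      refine integral_mono ((integrable_const _).indicator hA) hφ.integrable fun y => ?_
      refine Set.indicator_le' (f := fun _ => φ x * Real.exp (L * (G.ε / 2))) (g := φ)
        (fun z hz => ?_) (fun z _ => (Real.exp_pos _).le) y
      rw [← Real.exp_add, ← mul_add]
      exact Real.exp_le_exp.2 (mul_le_mul_of_nonneg_left hz hL.le)
  have h3 := mul_le_mul_of_nonneg_left h2 hβ.le
  have h4 := mul_le_mul_of_nonneg_right hLκ (Real.exp_pos (L * x.1 i)).le
  change 2 * φ x ≤ _ * φ x at h4
  linarith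

section Game

variable {SI SII : G.Strategy} {x₀ : G.Board} {F : G.strip → ℝ}

/-! ### Termination -/

theorem integral_pos_zero (hu : G.BorelBdd C u) :
    ∫ ω, u (G.pos 0 (ω 0)) ∂(G.law SI SII x₀) = u x₀ := by
  have hm : Measurable fun h : G.History 0 => u (G.current h) :=
    hu.measurable.comp (G.measurable_current 0)
  have h1 := integral_map (μ := G.law SI SII x₀)
    (Preorder.measurable_frestrictLe (X := G.Stage) 0).aemeasurable hm.aestronglyMeasurable
  rw [map_law_frestrictLe, Kernel.partialTraj_self, Kernel.id_apply,
    integral_dirac' _ _ hm.stronglyMeasurable] at h1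
  exact h1.symm

/-- Almost surely the game ends, because the expected duration is finite. -/
theorem ae_terminates (hn : 1 ≤ n) (SI SII : G.Strategy) (x₀ : G.Board) :
    ∀ᵐ ω ∂(G.law SI SII x₀), G.Terminates ω := by
  obtain ⟨C, δ, φ, hφ, hδ, hφ0, hφx⟩ := exists_lyapunov hn G
  set μ := G.law SI SII x₀
  set p := μ.real {ω | ¬ G.Terminates ω} with hp
  have hα := G.α_pos
  have hI := G.measurableSet_interiorBoard
  have hδI : G.BorelBdd δ (G.interiorBoard.indicator fun _ => δ) :=
    ⟨measurable_const.indicator hI, fun x => by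
      by_cases hx : x ∈ G.interiorBoard <;> simp [hx, abs_of_pos hδ, hδ.le]⟩
  -- The gain `δ` is claimed only in `Ω`, since the token is frozen elsewhere.
  have hv : G.BorelBdd (C + δ) (fun x => φ x + G.interiorBoard.indicator (fun _ => δ) x) :=
    ⟨hφ.measurable.add hδI.measurable, fun x =>
      (abs_add_le _ _).trans (add_le_add (hφ.abs_le x) (hδI.abs_le x))⟩
  have hstep : ∀ k, ∫ ω, φ (G.pos k (ω k)) ∂μ + δ * p ≤ ∫ ω, φ (G.pos (k + 1) (ω (k + 1))) ∂μ := by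
    intro k
    have h1 := integral_pos_le_integral_pos_succ (SI := SI) (SII := SII) (x₀ := x₀) hφ hv k
      (fun h hx => by
        simp only [Set.indicator_of_mem hx]
        have h2 := mul_nonneg (half_pos hα).le (hφ0 (SI.move k h))
        have h3 := mul_nonneg (half_pos hα).le (hφ0 (SII.move k h))
        linarith [hφx _ hx])
      (fun x hx => by simp [Set.indicator_of_notMem hx])
    have hm := measurable_pos_apply (G := G) k
    rw [integral_add (hφ.integrable_comp hm) (hδI.integrable_comp hm)] at h1
    have h2 : ∫ ω, G.interiorBoard.indicator (fun _ => δ) (G.pos k (ω k)) ∂μ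
        = μ.real ((fun ω => G.pos k (ω k)) ⁻¹' G.interiorBoard) * δ := by
      rw [← smul_eq_mul, ← integral_indicator_const _ (hm hI)]
      rfl
    -- A run that never ends is in `Ω` at every time.
    have h3 : p ≤ μ.real ((fun ω => G.pos k (ω k)) ⁻¹' G.interiorBoard) :=
      measureReal_mono fun ω hω => by
        by_contra hk
        exact hω ⟨k, hk⟩
    have h4 := mul_le_mul_of_nonneg_right h3 hδ.le
    linarith
  have hsum : ∀ k : ℕ, k * (δ * p) ≤ ∫ ω, φ (G.pos k (ω k)) ∂μ := by
    intro k
    induction k with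
    | zero => simpa using integral_nonneg fun ω : G.Run => hφ0 _
    | succ k ih =>
      push_cast
      linarith [hstep k]
  have hC : ∀ k : ℕ, k * (δ * p) ≤ C := fun k => by
    refine (hsum k).trans ?_
    simpa using integral_mono (μ := μ) (hφ.integrable_comp (measurable_pos_apply k))
      (integrable_const C) fun ω => hφ.le _
  have hp0 : p = 0 := by
    refine le_antisymm (not_lt.1 fun hpos => ?_) measureReal_nonneg
    obtain ⟨k, hk⟩ := exists_nat_gt (C / (δ * p))
    rw [div_lt_iff₀ (by positivity)] at hk
    exact (hC k).not_gt hk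
  exact (measureReal_eq_zero_iff).1 hp0

/-- Minimality of the exit time can be forgotten, since the token almost surely stays where it left
`Ω`. -/
theorem exists_payoff_eq (F : G.strip → ℝ) {ω : G.Run} (h : G.Terminates ω) :
    ∃ k, ∃ hk : G.pos k (ω k) ∉ G.interiorBoard, G.payoff F ω = F (G.toStrip _ hk) := by
  classical
  refine ⟨Nat.find h, Nat.find_spec h, ?_⟩
  rw [payoff, dif_pos h]

/-- Along almost every run, each extension of `F` is eventually equal to the payoff. -/
theorem ae_eventually_eq_payoff (hn : 1 ≤ n) (hu : ∀ y, u (G.ofStrip y) = F y) :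
    ∀ᵐ ω ∂(G.law SI SII x₀), ∀ᶠ k in atTop, u (G.pos k (ω k)) = G.payoff F ω := by
  filter_upwards [ae_terminates hn SI SII x₀, ae_pos_succ_eq] with ω hω hstay
  obtain ⟨k, hk, hF⟩ := exists_payoff_eq F hω
  filter_upwards [eventually_ge_atTop k] with l hl
  have hpos : G.pos l (ω l) = G.pos k (ω k) := by
    induction l, hl using Nat.le_induction with
    | base => rfl
    | succ l _ ih => rw [hstay l (ih ▸ hk), ih]
  rw [hpos, hF, ← hu]
  rfl

theorem abs_payoff_le (hC : 0 ≤ C) (hFC : ∀ y, |F y| ≤ C) (ω : G.Run) : |G.payoff F ω| ≤ C := by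
  by_cases h : G.Terminates ω
  · obtain ⟨k, hk, hF⟩ := exists_payoff_eq F h
    rw [hF]
    exact hFC _
  · rw [payoff, dif_neg h, abs_zero]
    exact hC

/-- Measurability comes from the payoff being an almost sure limit of `u₀(x_k)`, without studying
the exit time. -/
theorem integrable_payoff (hn : 1 ≤ n) (hF : Measurable F) (hC : 0 ≤ C) (hFC : ∀ y, |F y| ≤ C) :
    Integrable (G.payoff F) (G.law SI SII x₀) := by
  have hb := borelBdd_iterStart hF hC hFC
  have hlim := ae_eventually_eq_payoff (SI := SI) (SII := SII) (x₀ := x₀) (F := F) hn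
    (u := G.iterStart F) fun y => iterStart_of_notMem F (x := G.ofStrip y) y.2.1
  refine .of_bound (aemeasurable_of_tendsto_metrizable_ae atTop
    (fun k => (hb.measurable.comp (measurable_pos_apply k)).aemeasurable)
    (hlim.mono fun ω h => tendsto_const_nhds.congr' (h.mono fun _ => Eq.symm))).aestronglyMeasurable
    C (.of_forall fun ω => abs_payoff_le hC hFC ω)

/-- This replaces optional stopping: the frozen token makes `u(x_k)` eventually equal to the payoff,
and `u` is bounded. -/
theorem tendsto_integral_pos (hn : 1 ≤ n) (hu : G.BorelBdd C u)
    (huF : ∀ y, u (G.ofStrip y) = F y) :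
    Tendsto (fun k => ∫ ω, u (G.pos k (ω k)) ∂(G.law SI SII x₀)) atTop
      (𝓝 (G.expectedPayoff F SI SII x₀)) :=
  tendsto_integral_of_dominated_convergence (fun _ => C)
    (fun k => (hu.measurable.comp (measurable_pos_apply k)).aestronglyMeasurable)
    (integrable_const _) (fun _ => .of_forall fun _ => hu.abs_le _)
    ((ae_eventually_eq_payoff hn huF).mono fun _ h =>
      tendsto_const_nhds.congr' (h.mono fun _ => Eq.symm))

/-! ### Almost optimal strategies -/

/-- If the expected value of `u` decreases by at most `η / 2 ^ (k + 1)` at step `k`, then it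
decreases by at most `η` along the game. -/
theorem sub_le_integral_pos (hu : G.BorelBdd C u) {η : ℝ} (hη : 0 ≤ η)
    (hstep : ∀ k (h : G.History k), G.current h ∈ G.interiorBoard →
      u (G.current h) - η / 2 ^ (k + 1) ≤ G.α / 2 * u (SI.move k h) + G.α / 2 * u (SII.move k h)
        + G.β * ∫ y, u y ∂(G.uniform (G.current h))) (k : ℕ) :
    u x₀ - η ≤ ∫ ω, u (G.pos k (ω k)) ∂(G.law SI SII x₀) := by
  -- The induction needs the exact partial sum of the errors `η / 2^(j+1)`, `j < k`.
  suffices h : u x₀ - η * (1 - 1 / 2 ^ k) ≤ ∫ ω, u (G.pos k (ω k)) ∂(G.law SI SII x₀) by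
    have h0 : 0 ≤ η * (1 / 2 ^ k) := by positivity
    linarith
  induction k with
  | zero => simp [integral_pos_zero hu]
  | succ k ih =>
    have he : 0 ≤ η / 2 ^ (k + 1) := by positivity
    have hv : G.BorelBdd (C + η / 2 ^ (k + 1)) (fun x => u x - η / 2 ^ (k + 1)) :=
      ⟨hu.measurable.sub_const _, fun x => (abs_sub _ _).trans
        (add_le_add (hu.abs_le x) (abs_of_nonneg he).le)⟩
    have h1 := integral_pos_le_integral_pos_succ (x₀ := x₀) hu hv k (hstep k)
      fun x _ => sub_le_self _ he
    rw [integral_sub (hu.integrable_comp (measurable_pos_apply k)) (integrable_const _)] at h1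
    simp only [integral_const, probReal_univ, one_smul] at h1
    have h2 : η * (1 - 1 / 2 ^ (k + 1)) = η * (1 - 1 / 2 ^ k) + η / 2 ^ (k + 1) := by
      field_simp
      ring
    linarith

theorem IsSolution.eq_of_mem (hu : G.IsSolution F u) {x : G.Board} (hx : x ∈ G.interiorBoard) :
    u x = G.α / 2 * (⨆ y : Metric.ball x G.ε, u y)
      + G.α / 2 * (⨅ y : Metric.ball x G.ε, u y) + G.β * ∫ y, u y ∂(G.uniform x) := by
  rw [← dppOp_of_mem G u hx, ← hu.dpp]

/-- Player I can guarantee a solution of the dynamic programming principle up to `η`. -/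
theorem IsSolution.exists_strategyI (hn : 1 ≤ n) (hu : G.IsSolution F u) {η : ℝ} (hη : 0 < η) :
    ∃ SI : G.Strategy, ∀ SII x, u x - η ≤ G.expectedPayoff F SI SII x := by
  obtain ⟨C, hC⟩ := hu.bounded
  have hb : G.BorelBdd C u := ⟨hu.measurable, hC⟩
  obtain ⟨SI, hSI⟩ := hb.exists_strategy_near_iSup (e := fun k => η / 2 ^ (k + 1))
    fun k => by positivity
  refine ⟨SI, fun SII x => ge_of_tendsto' (tendsto_integral_pos hn hb hu.boundary)
    (sub_le_integral_pos hb hη.le fun k h hx => ?_)⟩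
  have hα := G.α_pos
  have he : 0 < η / 2 ^ (k + 1) := by positivity
  have h1 := mul_le_mul_of_nonneg_left (hSI k h) (half_pos hα).le
  -- An arbitrary move of Player II costs no more than the infimum over the ball.
  have h2 := mul_le_mul_of_nonneg_left
    (ciInf_le (hb.bddBelow _) ⟨SII.move k h, SII.move_mem k h hx⟩) (half_pos hα).le
  have h3 : G.α / 2 * (η / 2 ^ (k + 1)) ≤ η / 2 ^ (k + 1) :=
    mul_le_of_le_one_left he.le (by linarith [G.β_pos, G.add_eq_one])
  rw [hu.eq_of_mem hx]
  linarith

/-- Player II can guarantee a solution of the dynamic programming principle up to `η`. -/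
theorem IsSolution.exists_strategyII (hn : 1 ≤ n) (hu : G.IsSolution F u) {η : ℝ} (hη : 0 < η) :
    ∃ SII : G.Strategy, ∀ SI x, G.expectedPayoff F SI SII x ≤ u x + η := by
  obtain ⟨C, hC⟩ := hu.bounded
  have hb : G.BorelBdd C u := ⟨hu.measurable, hC⟩
  obtain ⟨SII, hSII⟩ := hb.exists_strategy_near_iInf (e := fun k => η / 2 ^ (k + 1))
    fun k => by positivity
  refine ⟨SII, fun SI x => le_of_tendsto' (tendsto_integral_pos hn hb hu.boundary) fun k => ?_⟩
  have key := sub_le_integral_pos (SI := SI) (SII := SII) (x₀ := x) hb.neg hη.le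
    (fun k h hx => ?_) k
  · simp only [Pi.neg_apply, integral_neg] at key
    linarith
  have hα := G.α_pos
  have he : 0 < η / 2 ^ (k + 1) := by positivity
  have h1 := mul_le_mul_of_nonneg_left (hSII k h) (half_pos hα).le
  have h2 := mul_le_mul_of_nonneg_left
    (le_ciSup (hb.bddAbove _) ⟨SI.move k h, SI.move_mem k h hx⟩) (half_pos hα).le
  have h3 : G.α / 2 * (η / 2 ^ (k + 1)) ≤ η / 2 ^ (k + 1) :=
    mul_le_of_le_one_left he.le (by linarith [G.β_pos, G.add_eq_one])
  simp only [Pi.neg_apply, integral_neg]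
  rw [hu.eq_of_mem hx]
  linarith

/-! ### The value of the game -/

theorem abs_expectedPayoff_le (hC : 0 ≤ C) (hFC : ∀ y, |F y| ≤ C) :
    |G.expectedPayoff F SI SII x₀| ≤ C := by
  simpa [expectedPayoff] using norm_integral_le_of_norm_le_const (μ := G.law SI SII x₀)
    (f := G.payoff F) (.of_forall fun ω => abs_payoff_le hC hFC ω)

/-- Each inequality fixes one player's `η`-optimal strategy. As the values do not involve `u`, this
also yields uniqueness. -/
theorem IsSolution.eq_value (hn : 1 ≤ n) (hFb : ∃ C : ℝ, ∀ y, |F y| ≤ C)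
    (hu : G.IsSolution F u) : u = G.valueI F ∧ u = G.valueII F := by
  obtain ⟨C₀, hC₀⟩ := hFb
  obtain ⟨C, hC, hFC⟩ : ∃ C, 0 ≤ C ∧ ∀ y, |F y| ≤ C :=
    ⟨|C₀|, abs_nonneg _, fun y => (hC₀ y).trans (le_abs_self _)⟩
  have hE := fun SI SII x => _root_.abs_le.1
    (abs_expectedPayoff_le (SI := SI) (SII := SII) (x₀ := x) hC hFC)
  -- Real suprema and infima of unbounded families are `0` by default, so all four bounds are needed
  -- below.
  have hbI : ∀ SI x, BddBelow (Set.range fun SII => G.expectedPayoff F SI SII x) := fun SI x =>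
    ⟨-C, by rintro _ ⟨SII, rfl⟩; exact (hE SI SII x).1⟩
  have hbII : ∀ SII x, BddAbove (Set.range fun SI => G.expectedPayoff F SI SII x) := fun SII x =>
    ⟨C, by rintro _ ⟨SI, rfl⟩; exact (hE SI SII x).2⟩
  have hI : ∀ x, BddAbove (Set.range fun SI => ⨅ SII, G.expectedPayoff F SI SII x) := fun x =>
    ⟨C, by
      rintro _ ⟨SI, rfl⟩
      exact (ciInf_le (hbI SI x) (Classical.arbitrary _)).trans (hE _ _ _).2⟩
  have hII : ∀ x, BddBelow (Set.range fun SII => ⨆ SI, G.expectedPayoff F SI SII x) := fun x =>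
    ⟨-C, by
      rintro _ ⟨SII, rfl⟩
      exact (hE _ _ _).1.trans (le_ciSup (hbII SII x) (Classical.arbitrary _))⟩
  constructor <;> refine funext fun x => le_antisymm ?_ ?_ <;>
    refine le_of_forall_pos_le_add fun η hη => ?_
  · obtain ⟨SI, hSI⟩ := hu.exists_strategyI hn hη
    have h1 : u x - η ≤ ⨅ SII, G.expectedPayoff F SI SII x := le_ciInf fun SII => hSI SII x
    exact sub_le_iff_le_add.1 (h1.trans (le_ciSup (hI x) SI))
  · obtain ⟨SII, hSII⟩ := hu.exists_strategyII hn hη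
    exact ciSup_le fun SI => (ciInf_le (hbI SI x) SII).trans (hSII SI x)
  · obtain ⟨SI, hSI⟩ := hu.exists_strategyI hn hη
    exact sub_le_iff_le_add.1
      (le_ciInf fun SII => (hSI SII x).trans (le_ciSup (hbII SII x) SI))
  · obtain ⟨SII, hSII⟩ := hu.exists_strategyII hn hη
    exact (ciInf_le (hII x) SII).trans (ciSup_le fun SI => hSII SI x)

end Game

end TugOfWar

end

theorem theorem3p2 {n : ℕ} (hn : 1 ≤ n) (G : TugOfWar n) (F : G.strip → ℝ)
    (hF : Measurable F) (hFb : ∃ C : ℝ, ∀ y, |F y| ≤ C) :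
    (∀ (SI SII : G.Strategy) (x : G.Board),
      (∀ᵐ ω ∂(G.law SI SII x), G.Terminates ω) ∧
        Integrable (G.payoff F) (G.law SI SII x)) ∧
    ∃ u : G.Board → ℝ,
      G.IsSolution F u ∧
      TendstoUniformly (G.iter F) u atTop ∧
      (∀ v : G.Board → ℝ, G.IsSolution F v → v = u) ∧
      u = G.valueI F ∧ u = G.valueII F ∧
      (∀ x, G.valueI F x = G.valueII F x) ∧
      Measurable (G.valueI F) := by
  obtain ⟨C, hC, hFC⟩ : ∃ C, 0 ≤ C ∧ ∀ y, |F y| ≤ C :=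
    let ⟨C₀, hC₀⟩ := hFb
    ⟨|C₀|, abs_nonneg _, fun y => (hC₀ y).trans (le_abs_self _)⟩
  obtain ⟨u, hu, hlim⟩ := TugOfWar.exists_tendstoUniformly_iter hF hC hFC
  have hsol := TugOfWar.isSolution_of_tendstoUniformly hF hC hFC hu hlim
  obtain ⟨hI, hII⟩ := hsol.eq_value hn hFb
  exact ⟨fun SI SII x => ⟨TugOfWar.ae_terminates hn SI SII x,
      TugOfWar.integrable_payoff hn hF hC hFC⟩,
    u, hsol, hlim, fun v hv => (hv.eq_value hn hFb).1.trans hI.symm, hI, hII,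
    fun x => congrFun (hI.symm.trans hII) x, hI ▸ hu.measurable⟩
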